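/- Write $\omega_d$ for the Lebesgue measure of the unit ball of $\mathbb{R}^d$ and $B(x,\varepsilon)$ for the closed Euclidean ball of radius $\varepsilon$ centred at $x$. There is an absolute constant $C>0$ such that the following holds. Let $\mathcal{M}_0\subset B(0,1)\subset\mathbb{R}^n$, and let $\mu_0$ be a probability measure on $\mathbb{R}^n$ supported on $\mathcal{M}_0$ (that is, $\mu_0(\mathbb{R}^n\setminus\mathcal{M}_0)=0$). Let $d\ge 0$ be an integer and $c>0$ a real number with $c^{-1}>e$ such that $$\mu_0(B(x,\varepsilon))>c\,\omega_d\,\varepsilon^d\qquad\text{for all }x\in\mathcal{M}_0\text{ and all }\varepsilon\in(0,2].$$ Let $\mathfrak{S}\subseteq\mathbb{R}^n$ be an affine subspace of dimension $D\ge 1$, identified isometrically with $\mathbb{R}^D$, let $\Pi$ be the orthogonal projection onto $\mathfrak{S}$, and let $K=\operatorname{conv}(\Pi\mathcal{M}_0)\subset\mathbb{R}^D$. Let $0<\sigma\le 1$, let $Z\sim\mathcal{N}(0,\sigma^2 I_D)$, let $x\in\mathbb{R}^D$, and let $$X_\nu=\langle Z/\sigma,\ \nu-x\rangle,\qquad \nu\in\sigma^{-1}K.$$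 Then $\sup_{\nu\in\sigma^{-1}K}X_\nu$ is everywhere finite and integrable, and $$\mathbb{E}\Big[\sup_{\nu\in\sigma^{-1}K}X_\nu\Big]\le J,\qquad J=C\left(\frac1{\sqrt D}+\sqrt{\log\left(\frac{(2D)^d}{c\,\sigma^d\,\omega_d}\right)}\left[4\sigma^{-1}\log\left(\frac{2D}{\sigma}\right)+C\sigma^{-1}\right]\right).$$ -/

import Mathlib

open MeasureTheory ProbabilityTheory
open scoped Pointwise

noncomputable section

/-- `ω_d`, the Lebesgue measure of the unit ball of `d`-dimensional Euclidean space. -/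
def unitBallVolume (d : ℕ) : ℝ :=
  (volume (Metric.ball (0 : EuclideanSpace ℝ (Fin d)) 1)).toReal

/-- The lower-mass condition with constant `c` and dimension parameter `d` for a measure `μ₀` on a
set `M₀`: `μ₀ (B(x, ε)) > c ω_d ε ^ d` for all `x ∈ M₀` and all `ε ∈ (0, 2]`. -/
def LowerMassCondition {n : ℕ} (μ₀ : Measure (EuclideanSpace ℝ (Fin n)))
    (M₀ : Set (EuclideanSpace ℝ (Fin n))) (c : ℝ) (d : ℕ) : Prop :=
  ∀ x ∈ M₀, ∀ ε : ℝ, 0 < ε → ε ≤ 2 →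
    c * unitBallVolume d * ε ^ d < (μ₀ (Metric.closedBall x ε)).toReal

/-- The orthogonal projection of `M₀ ⊆ ℝⁿ` onto the affine subspace `S`, seen as a subset of `ℝᴰ`
through the isometric coordinates `φ` of `S`. -/
def projectedSet {n D : ℕ} (S : AffineSubspace ℝ (EuclideanSpace ℝ (Fin n))) [Nonempty S]
    (φ : S ≃ᵃⁱ[ℝ] EuclideanSpace ℝ (Fin D)) (M₀ : Set (EuclideanSpace ℝ (Fin n))) :
    Set (EuclideanSpace ℝ (Fin D)) :=
  (fun p => φ (EuclideanGeometry.orthogonalProjection S p)) '' M₀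

/-- The process `X_ν = ⟨Z / σ, ν - x⟩`. -/
def gaussianProcess {Ω : Type*} {D : ℕ} (Z : Ω → EuclideanSpace ℝ (Fin D)) (σ : ℝ)
    (x ν : EuclideanSpace ℝ (Fin D)) (ω : Ω) : ℝ :=
  inner ℝ (σ⁻¹ • Z ω) (ν - x)

/-- `J = C (1/√D + √(log ((2D)^d / (c σ^d ω_d))) [4 σ⁻¹ log (2D/σ) + C σ⁻¹])`. -/
def boundJ (C c σ : ℝ) (d D : ℕ) : ℝ :=
  C * (1 / √(D : ℝ) +
    √(Real.log ((2 * (D : ℝ)) ^ d / (c * σ ^ d * unitBallVolume d))) *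
      (4 * σ⁻¹ * Real.log (2 * (D : ℝ) / σ) + C * σ⁻¹))

end

/-! No chaining is needed: one net at scale `σ / D` suffices. Balls of radius `σ / (2D)` around
points of `M₀` have mass at least `1 / A`, where `A` is the argument of the logarithm in `boundJ`,
so `M₀` has a `σ / D`-net of at most `A` points (`exists_finset_net_of_le_measureReal`), and the
1-Lipschitz projection carries it to the projected set. A linear functional is bounded on a convex
hull by its bound on the generators, so with `g = Z / σ` the supremum over `K` is at most a maximum
over the net plus `(σ / D) ‖g‖`, up to a shift of mean zero. The maximum has mean at most `2 √(log
A)` and `E ‖g‖ ≤ √D`; dilating by `σ⁻¹` gives `2 σ⁻¹ √(log A) + 1 / √D`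
(`integral_iSup_inner_le_of_net`). -/

/-- Scaling a centred Gaussian vector with covariance `σ² I` by `σ⁻¹` makes it standard. -/
theorem hasLaw_smul_stdGaussian {Ω ι : Type*} [Fintype ι] [DecidableEq ι] [MeasurableSpace Ω]
    {P : Measure Ω} {Z : Ω → EuclideanSpace ℝ ι} {σ : ℝ} (hσ : 0 < σ)
    (hZ : HasLaw Z (multivariateGaussian 0 (σ ^ 2 • (1 : Matrix ι ι ℝ))) P) :
    HasLaw (fun ω => σ⁻¹ • Z ω) (stdGaussian (EuclideanSpace ℝ ι)) P := by
  have hS : (σ ^ 2 • (1 : Matrix ι ι ℝ)).PosSemidef :=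
    Matrix.PosSemidef.one.smul (by positivity)
  refine HasLaw.fun_comp (Y := fun z : EuclideanSpace ℝ ι => σ⁻¹ • z) ⟨by fun_prop, ?_⟩ hZ
  apply Measure.ext_of_charFun
  ext t
  rw [charFun_map_smul, charFun_multivariateGaussian hS, charFun_stdGaussian]
  congr 1
  have h : (t.ofLp ⬝ᵥ t.ofLp : ℝ) = ‖t‖ ^ 2 := by
    rw [EuclideanSpace.real_norm_sq_eq, dotProduct]
    simp [sq]
  have h2 : ((σ⁻¹ • t).ofLp ⬝ᵥ (σ ^ 2 • (1 : Matrix ι ι ℝ)).mulVec (σ⁻¹ • t).ofLp : ℝ)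
      = ‖t‖ ^ 2 := by
    rw [← h]
    simp [Matrix.smul_mulVec, dotProduct_smul, smul_dotProduct]
    field_simp
  rw [h2]
  simp [neg_div]

/-! ### Linearised log-sum-exp -/

section SoftMax

variable {E : Type*} [NormedAddCommGroup E] [InnerProductSpace ℝ E]

/-- A smooth majorant of the maximum of the linear functionals given by a finite set `F`. -/
noncomputable def softMax (F : Finset E) (s a : ℝ) (z : E) : ℝ :=
  s⁻¹ * (a - 1 + Real.exp (-a) * ∑ v ∈ F, Real.exp (s * inner ℝ z v))

theorem inner_le_softMax {F : Finset E} {s : ℝ} (hs : 0 < s) (a : ℝ) {v : E} (hv : v ∈ F)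
    (z : E) : inner ℝ z v ≤ softMax F s a z := by
  -- Tangent line of `log` at `exp a`: `log y ≤ a - 1 + exp (-a) * y`.
  have h1 : s * inner ℝ z v ≤ a - 1 + Real.exp (-a) * Real.exp (s * inner ℝ z v) := by
    rw [← Real.exp_add]
    linarith [Real.add_one_le_exp (-a + s * inner ℝ z v)]
  have h2 : Real.exp (s * inner ℝ z v) ≤ ∑ v ∈ F, Real.exp (s * inner ℝ z v) :=
    Finset.single_le_sum (f := fun v => Real.exp (s * inner ℝ z v))
      (fun _ _ => (Real.exp_pos _).le) hv
  have h3 := mul_le_mul_of_nonneg_left h2 (Real.exp_pos (-a)).le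
  rw [softMax, inv_mul_eq_div, le_div_iff₀ hs]
  linarith

/-- A linear functional on a convex hull is bounded through a finite net of the generating set. -/
theorem inner_le_of_mem_convexHull {T : Set E} {F : Finset E} {p : E} {s ε : ℝ} (hs : 0 < s)
    (a : ℝ) (hT : ∀ t ∈ T, ∃ v ∈ F, ‖t - p - v‖ ≤ ε) {k : E} (hk : k ∈ convexHull ℝ T) (z : E) :
    inner ℝ z k ≤ inner ℝ z p + (softMax F s a z + ε * ‖z‖) := by
  have hconv : Convex ℝ {k : E | inner ℝ z k ≤ inner ℝ z p + (softMax F s a z + ε * ‖z‖)} :=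
    convex_halfSpace_le (innerSL ℝ z).isLinear _
  refine convexHull_min (fun t ht => ?_) hconv hk
  obtain ⟨v, hv, htv⟩ := hT t ht
  have h1 := inner_le_softMax hs a hv z
  have h2 : inner ℝ z (t - p - v) ≤ ε * ‖z‖ :=
    (real_inner_le_norm _ _).trans (by rw [mul_comm]; gcongr)
  rw [inner_sub_right, inner_sub_right] at h2
  simp only [Set.mem_ofPred_eq]
  linarith

end SoftMax

/-! ### Gaussian moments and widths -/

section StdGaussian

variable {E : Type*} [NormedAddCommGroup E] [InnerProductSpace ℝ E] [FiniteDimensional ℝ E]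
  [MeasurableSpace E] [BorelSpace E]

theorem stdGaussian_map_inner (v : E) :
    (stdGaussian E).map (fun z => inner ℝ z v) = gaussianReal 0 (‖v‖ ^ 2).toNNReal := by
  have h := IsGaussian.map_eq_gaussianReal (μ := stdGaussian E) (innerSL ℝ v)
  rw [integral_strongDual_stdGaussian, variance_dual_stdGaussian, innerSL_apply_norm] at h
  rw [← h]
  congr 1
  ext z
  simp [real_inner_comm]

theorem integrable_inner_stdGaussian (v : E) :
    Integrable (fun z => inner ℝ z v) (stdGaussian E) := by
  simpa [real_inner_comm] using IsGaussian.integrable_dual (stdGaussian E) (innerSL ℝ v)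

theorem integral_inner_stdGaussian (v : E) : ∫ z, inner ℝ z v ∂stdGaussian E = 0 := by
  simpa [real_inner_comm] using integral_strongDual_stdGaussian (innerSL ℝ v)

theorem integrable_exp_mul_inner_stdGaussian (s : ℝ) (v : E) :
    Integrable (fun z => Real.exp (s * inner ℝ z v)) (stdGaussian E) := by
  have h := integrable_exp_mul_gaussianReal (μ := 0) (v := (‖v‖ ^ 2).toNNReal) s
  rw [← stdGaussian_map_inner] at h
  exact h.comp_measurable (by fun_prop)

theorem integral_exp_mul_inner_stdGaussian (s : ℝ) (v : E) :
    ∫ z, Real.exp (s * inner ℝ z v) ∂stdGaussian E = Real.exp (s ^ 2 * ‖v‖ ^ 2 / 2) := by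
  have h := mgf_gaussianReal (stdGaussian_map_inner v) s
  rw [mgf] at h
  rw [h, Real.coe_toNNReal _ (by positivity)]
  ring_nf

theorem integral_sq_norm_stdGaussian :
    ∫ z : E, ‖z‖ ^ 2 ∂stdGaussian E = Module.finrank ℝ E := by
  let b := stdOrthonormalBasis ℝ E
  have hL (i) : MemLp (fun z : E => inner ℝ z (b i)) 2 (stdGaussian E) := by
    simpa [real_inner_comm] using
      IsGaussian.memLp_dual (stdGaussian E) (innerSL ℝ (b i)) 2 (by simp)
  have hV (i) : ∫ z : E, inner ℝ z (b i) ^ 2 ∂stdGaussian E = 1 := by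
    have h := variance_dual_stdGaussian (innerSL ℝ (b i))
    rw [innerSL_apply_norm, b.norm_eq_one, variance_of_integral_eq_zero (by fun_prop)
      (integral_strongDual_stdGaussian _)] at h
    simpa [real_inner_comm] using h
  simp_rw [← b.sum_sq_inner_left]
  rw [integral_finsetSum _ fun i _ => (hL i).integrable_sq]
  simp [hV]

theorem integrable_norm_stdGaussian : Integrable (fun z : E => ‖z‖) (stdGaussian E) :=
  (IsGaussian.integrable_id (μ := stdGaussian E)).norm

theorem integral_norm_stdGaussian_le :
    ∫ z : E, ‖z‖ ∂stdGaussian E ≤ √(Module.finrank ℝ E) := by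
  -- Nonnegative variance gives `(E ‖z‖)² ≤ E ‖z‖²`.
  have h := variance_nonneg (fun z : E => ‖z‖) (stdGaussian E)
  have hm : MemLp (fun z : E => ‖z‖) 2 (stdGaussian E) :=
    (IsGaussian.memLp_two_id (μ := stdGaussian E)).norm
  rw [variance_eq_sub hm] at h
  simp only [Pi.pow_apply, integral_sq_norm_stdGaussian] at h
  exact Real.le_sqrt_of_sq_le (by linarith)

theorem integrable_softMax (F : Finset E) (s a : ℝ) :
    Integrable (softMax F s a) (stdGaussian E) :=
  ((integrable_const _).add ((integrable_finsetSum _ fun v _ =>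
    integrable_exp_mul_inner_stdGaussian s v).const_mul _)).const_mul _

/-- The maximal inequality for finitely many centred Gaussians of variance at most one. -/
theorem integral_softMax_le {F : Finset E} (hF : ∀ v ∈ F, ‖v‖ ≤ 1) {L : ℝ} (hL : 0 < L)
    (hcard : (F.card : ℝ) ≤ Real.exp L) :
    ∫ z, softMax F (√L) (L + L / 2) z ∂stdGaussian E ≤ 2 * √L := by
  have hs : 0 < √L := Real.sqrt_pos.2 hL
  have hsq : √L ^ 2 = L := Real.sq_sqrt hL.le
  simp only [softMax]
  rw [integral_const_mul, integral_add (integrable_const _) ((integrable_finsetSum _ fun v _ =>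
    integrable_exp_mul_inner_stdGaussian _ v).const_mul _), integral_const_mul,
    integral_finsetSum _ fun v _ => integrable_exp_mul_inner_stdGaussian _ v]
  simp only [integral_exp_mul_inner_stdGaussian, integral_const, probReal_univ, one_smul, hsq]
  have h1 : ∑ v ∈ F, Real.exp (L * ‖v‖ ^ 2 / 2) ≤ Real.exp (L + L / 2) := by
    calc ∑ v ∈ F, Real.exp (L * ‖v‖ ^ 2 / 2) ≤ ∑ _v ∈ F, Real.exp (L / 2) := by
          refine Finset.sum_le_sum fun v hv => Real.exp_le_exp.2 ?_
          have := pow_le_one₀ (n := 2) (norm_nonneg v) (hF v hv)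
          nlinarith
      _ = F.card * Real.exp (L / 2) := by simp
      _ ≤ Real.exp L * Real.exp (L / 2) := by gcongr
      _ = _ := by rw [← Real.exp_add]
  -- The choice `a = 3L/2` makes this term at most one, so the integral is at most `a / √L = (3/2)
  -- √L`.
  have h2 : Real.exp (-(L + L / 2)) * ∑ v ∈ F, Real.exp (L * ‖v‖ ^ 2 / 2) ≤ 1 := by
    calc _ ≤ Real.exp (-(L + L / 2)) * Real.exp (L + L / 2) := by gcongr
      _ = 1 := by rw [← Real.exp_add]; simp
  rw [inv_mul_eq_div, div_le_iff₀ hs]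
  nlinarith

/-- The width of a dilated convex hull is controlled by a finite net of the generating set. -/
theorem integral_iSup_inner_le_of_net {Ω : Type*} [MeasurableSpace Ω] {P : Measure Ω}
    {g : Ω → E} (hg : HasLaw g (stdGaussian E) P) {T : Set E} (hne : T.Nonempty) {F : Finset E}
    {p : E} {ε L r : ℝ} (hL : 0 < L) (hr : 0 < r) (hε : 0 ≤ ε)
    (hT : ∀ t ∈ T, ∃ v ∈ F, ‖t - p - v‖ ≤ ε) (hF : ∀ v ∈ F, ‖v‖ ≤ 1)
    (hcard : (F.card : ℝ) ≤ Real.exp L) (x : E) :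
    (∀ ω, BddAbove (Set.range fun ν : (r • convexHull ℝ T : Set E) => inner ℝ (g ω) (ν - x))) ∧
    Integrable (fun ω => ⨆ ν : (r • convexHull ℝ T : Set E), inner ℝ (g ω) (ν - x)) P ∧
    ∫ ω, (⨆ ν : (r • convexHull ℝ T : Set E), inner ℝ (g ω) (ν - x)) ∂P ≤
      r * (2 * √L + ε * √(Module.finrank ℝ E)) := by
  set B : E → ℝ := fun z => inner ℝ z (r • p - x) +
    r * (softMax F (√L) (L + L / 2) z + ε * ‖z‖) with hB
  set h : E → ℝ := fun z => ⨆ ν : (r • convexHull ℝ T : Set E), inner ℝ z (ν - x) with hh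
  have hle (z : E) (ν : (r • convexHull ℝ T : Set E)) : inner ℝ z (ν - x) ≤ B z := by
    obtain ⟨ν, k, hk, rfl⟩ := ν
    have := inner_le_of_mem_convexHull (Real.sqrt_pos.2 hL) (L + L / 2) hT hk z
    simp only [hB, inner_sub_right, inner_smul_right]
    nlinarith
  have hbdd (z : E) : BddAbove (Set.range fun ν : (r • convexHull ℝ T : Set E) =>
      inner ℝ z (ν - x)) := ⟨B z, by rintro _ ⟨ν, rfl⟩; exact hle z ν⟩
  obtain ⟨t, ht⟩ := hne
  let ν₀ : (r • convexHull ℝ T : Set E) :=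
    ⟨r • t, Set.smul_mem_smul_set (subset_convexHull ℝ T ht)⟩
  have : Nonempty (r • convexHull ℝ T : Set E) := ⟨ν₀⟩
  have hhB (z : E) : h z ≤ B z := ciSup_le (hle z)
  have hlow (z : E) : inner ℝ z ((ν₀ : E) - x) ≤ h z := le_ciSup (hbdd z) ν₀
  -- The supremum is uncountable; measurability comes from lower semicontinuity.
  have hmeas : Measurable h :=
    (lowerSemicontinuous_ciSup hbdd fun ν => Continuous.lowerSemicontinuous
      (by fun_prop)).measurable
  have hS := integrable_softMax F (√L) (L + L / 2)
  have hN := (integrable_norm_stdGaussian (E := E)).const_mul ε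
  have hSN : Integrable (fun z => softMax F (√L) (L + L / 2) z + ε * ‖z‖) (stdGaussian E) :=
    hS.add hN
  have hBint : Integrable B (stdGaussian E) :=
    (integrable_inner_stdGaussian _).add (hSN.const_mul r)
  have hint : Integrable h (stdGaussian E) :=
    integrable_of_le_of_le hmeas.aestronglyMeasurable (ae_of_all _ hlow) (ae_of_all _ hhB)
      (integrable_inner_stdGaussian _) hBint
  refine ⟨fun ω => hbdd (g ω), ?_, ?_⟩
  · rw [← hg.map_eq] at hint
    exact hint.comp_aemeasurable hg.aemeasurable
  · have h1 : ∫ ω, h (g ω) ∂P = ∫ z, h z ∂stdGaussian E :=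
      hg.integral_comp hmeas.aestronglyMeasurable
    refine h1.trans_le ((integral_mono hint hBint hhB).trans ?_)
    simp only [hB]
    rw [integral_add (integrable_inner_stdGaussian _) (hSN.const_mul r),
      integral_inner_stdGaussian, integral_const_mul, integral_add hS hN, integral_const_mul,
      zero_add]
    gcongr
    · exact integral_softMax_le hF hL hcard
    · exact integral_norm_stdGaussian_le

end StdGaussian

/-! ### Packing and auxiliary bounds -/

/-- A set on which balls of radius `r` have mass at least `m` has a `2r`-net of size at most
`m⁻¹`. -/
theorem exists_finset_net_of_le_measureReal {X : Type*} [MetricSpace X] [MeasurableSpace X]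
    [OpensMeasurableSpace X] (μ : Measure X) [IsProbabilityMeasure μ] {A : Set X} {r m : ℝ}
    (hr : 0 ≤ r) (hm : 0 < m) (hA : ∀ x ∈ A, m ≤ μ.real (Metric.closedBall x r)) :
    ∃ F : Finset X, (∀ y ∈ F, y ∈ A) ∧ (∀ x ∈ A, ∃ y ∈ F, dist x y ≤ 2 * r) ∧
      F.card * m ≤ 1 := by
  classical
  -- Separated families have disjoint `r`-balls, which bounds their size; one of maximal cardinality
  -- is a net.
  let Sep : Set (Finset X) :=
    {F | (∀ y ∈ F, y ∈ A) ∧ (F : Set X).Pairwise fun x y => 2 * r < dist x y}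
  have hcard (F : Finset X) (hF : F ∈ Sep) : F.card * m ≤ 1 := by
    have hd : Set.PairwiseDisjoint (F : Set X) fun x => Metric.closedBall x r :=
      fun x hx y hy hxy => Metric.closedBall_disjoint_closedBall
        (by linarith [hF.2 hx hy hxy])
    calc (F.card : ℝ) * m = ∑ _x ∈ F, m := by simp
      _ ≤ ∑ x ∈ F, μ.real (Metric.closedBall x r) :=
          Finset.sum_le_sum fun x hx => hA x (hF.1 x hx)
      _ = μ.real (⋃ x ∈ F, Metric.closedBall x r) :=
          (measureReal_biUnion_finset hd fun _ _ => Metric.isClosed_closedBall.measurableSet).symm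
      _ ≤ 1 := measureReal_le_one
  have hbdd : BddAbove (Finset.card '' Sep) := by
    refine ⟨⌈m⁻¹⌉₊, ?_⟩
    rintro _ ⟨F, hF, rfl⟩
    have h1 : (F.card : ℝ) ≤ m⁻¹ := by
      rw [inv_eq_one_div, le_div_iff₀ hm]; exact hcard F hF
    exact_mod_cast h1.trans (Nat.le_ceil _)
  obtain ⟨F, hF, hmax⟩ := Nat.sSup_mem (s := Finset.card '' Sep) ⟨0, ∅, by simp [Sep], rfl⟩ hbdd
  refine ⟨F, hF.1, fun x hx => ?_, hcard F hF⟩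
  by_contra! hfar
  have hxF : x ∉ F := fun h => by
    have := hfar x h
    rw [dist_self] at this
    linarith
  have hins : insert x F ∈ Sep := by
    refine ⟨fun y hy => ?_, ?_⟩
    · rcases Finset.mem_insert.1 hy with rfl | hy
      exacts [hx, hF.1 y hy]
    · rw [Finset.coe_insert, Set.pairwise_insert]
      exact ⟨hF.2, fun y hy _ => ⟨hfar y hy, by rw [dist_comm]; exact hfar y hy⟩⟩
  have := le_csSup hbdd ⟨_, hins, rfl⟩
  rw [← hmax, Finset.card_insert_of_notMem hxF] at this
  omega

theorem unitBallVolume_pos (d : ℕ) : 0 < unitBallVolume d :=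
  ENNReal.toReal_pos (Metric.measure_ball_pos volume _ one_pos).ne' measure_ball_lt_top.ne

theorem dist_orthogonalProjection_le {V Q : Type*} [NormedAddCommGroup V] [InnerProductSpace ℝ V]
    [MetricSpace Q] [NormedAddTorsor V Q] (S : AffineSubspace ℝ Q) [Nonempty S]
    [S.direction.HasOrthogonalProjection] (p q : Q) :
    dist (EuclideanGeometry.orthogonalProjection S p)
      (EuclideanGeometry.orthogonalProjection S q) ≤ dist p q := by
  rw [dist_eq_norm_vsub S.direction, dist_eq_norm_vsub V p q,
    ← ContinuousAffineMap.contLinear_map_vsub,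
    EuclideanGeometry.orthogonalProjection_contLinear]
  exact Submodule.norm_orthogonalProjectionOnto_apply_le _ _

/-- The logarithm in `boundJ` is at least one when the mass bound at radius two is consistent. -/
theorem one_le_log_packing {c σ : ℝ} {d D : ℕ} (hD : 0 < D) (hc : 0 < c)
    (hce : Real.exp 1 < c⁻¹) (hσ : 0 < σ) (hσ1 : σ ≤ 1)
    (hmass : c * unitBallVolume d * 2 ^ d < 1) :
    1 ≤ Real.log ((2 * (D : ℝ)) ^ d / (c * σ ^ d * unitBallVolume d)) := by
  have hω := unitBallVolume_pos d
  have hD1 : (1 : ℝ) ≤ D := by exact_mod_cast hD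
  rw [Real.le_log_iff_exp_le (by positivity)]
  -- For `d = 0` the argument is `c⁻¹ > e`; for `d ≥ 1` the mass bound at radius two makes it at
  -- least `4 ^ d`.
  rcases Nat.eq_zero_or_pos d with rfl | hd
  · have h0 : unitBallVolume 0 = 1 := by
      have hu : Metric.ball (0 : EuclideanSpace ℝ (Fin 0)) 1 = Set.univ :=
        Set.eq_univ_of_forall fun y => by simp [Subsingleton.elim y 0]
      have hp := (PiLp.volume_preserving_ofLp (Fin 0)).measure_preimage
        MeasurableSet.univ.nullMeasurableSet
      rw [Set.preimage_univ] at hp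
      rw [unitBallVolume, hu, hp]
      simp [volume_pi]
    simpa [h0] using hce.le
  · have h4 : Real.exp 1 ≤ 4 ^ d :=
      calc Real.exp 1 ≤ 4 := by linarith [Real.exp_one_lt_d9]
        _ = 4 ^ 1 := by norm_num
        _ ≤ 4 ^ d := pow_le_pow_right₀ (by norm_num) hd
    refine h4.trans ?_
    rw [le_div_iff₀ (by positivity)]
    calc (4 : ℝ) ^ d * (c * σ ^ d * unitBallVolume d)
        = 2 ^ d * σ ^ d * (c * unitBallVolume d * 2 ^ d) := by
          rw [show (4 : ℝ) = 2 * 2 by norm_num, mul_pow]; ring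
      _ ≤ 2 ^ d * 1 * 1 := by
          gcongr
          exact pow_le_one₀ hσ.le hσ1
      _ ≤ (2 * (D : ℝ)) ^ d := by
          rw [mul_one, mul_one]
          gcongr
          linarith

/-! ### Assembly -/

theorem mainTheorem5 :
    ∃ C : ℝ, 0 < C ∧
      ∀ (n d D : ℕ) (c σ : ℝ)
        (M₀ : Set (EuclideanSpace ℝ (Fin n)))
        (μ₀ : Measure (EuclideanSpace ℝ (Fin n))) [IsProbabilityMeasure μ₀]
        (S : AffineSubspace ℝ (EuclideanSpace ℝ (Fin n))) [Nonempty S]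
        (φ : S ≃ᵃⁱ[ℝ] EuclideanSpace ℝ (Fin D))
        (x : EuclideanSpace ℝ (Fin D))
        (Ω : Type*) [MeasurableSpace Ω] (P : Measure Ω) [IsProbabilityMeasure P]
        (Z : Ω → EuclideanSpace ℝ (Fin D)),
        0 < D → 0 < c → Real.exp 1 < c⁻¹ → 0 < σ → σ ≤ 1 →
        M₀ ⊆ Metric.closedBall 0 1 →
        μ₀ M₀ᶜ = 0 →
        LowerMassCondition μ₀ M₀ c d →
        HasLaw Z (multivariateGaussian 0 (σ ^ 2 • (1 : Matrix (Fin D) (Fin D) ℝ))) P →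
        let K : Set (EuclideanSpace ℝ (Fin D)) := convexHull ℝ (projectedSet S φ M₀)
        (∀ ω, BddAbove (Set.range fun ν : (σ⁻¹ • K : Set (EuclideanSpace ℝ (Fin D))) =>
          gaussianProcess Z σ x ν ω)) ∧
        Integrable (fun ω => ⨆ ν : (σ⁻¹ • K : Set (EuclideanSpace ℝ (Fin D))),
          gaussianProcess Z σ x ν ω) P ∧
        ∫ ω, (⨆ ν : (σ⁻¹ • K : Set (EuclideanSpace ℝ (Fin D))),
          gaussianProcess Z σ x ν ω) ∂P ≤ boundJ C c σ d D := by
  refine ⟨2, two_pos, ?_⟩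
  intro n d D c σ M₀ μ₀ _ S _ φ x Ω _ P _ Z hD hc hce hσ hσ1 hM hμ hmass hZ K
  have hω := unitBallVolume_pos d
  have hD' : (0 : ℝ) < D := by exact_mod_cast hD
  have hD1 : (1 : ℝ) ≤ D := by exact_mod_cast hD
  have hne : M₀.Nonempty := by
    by_contra h
    rw [Set.not_nonempty_iff_eq_empty.1 h, Set.compl_empty, measure_univ] at hμ
    exact one_ne_zero hμ
  have hlog : 1 ≤ Real.log ((2 * (D : ℝ)) ^ d / (c * σ ^ d * unitBallVolume d)) := by
    obtain ⟨y, hy⟩ := hne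
    exact one_le_log_packing hD hc hce hσ hσ1
      ((hmass y hy 2 two_pos le_rfl).trans_le measureReal_le_one)
  simp only [boundJ]
  set A : ℝ := (2 * (D : ℝ)) ^ d / (c * σ ^ d * unitBallVolume d) with hA
  have hApos : 0 < A := by positivity
  obtain ⟨F, hFM, hFnet, hFcard⟩ := exists_finset_net_of_le_measureReal μ₀ (A := M₀)
    (r := σ / (2 * D)) (m := c * unitBallVolume d * (σ / (2 * D)) ^ d) (by positivity)
    (by positivity) fun y hy => (hmass y hy _ (by positivity) (by
      rw [div_le_iff₀ (by positivity)]; linarith)).le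
  have hFA : (F.card : ℝ) ≤ A := by
    rw [hA, le_div_iff₀ (by positivity)]
    rw [div_pow, mul_div_assoc', mul_div_assoc', div_le_one (by positivity)] at hFcard
    linarith
  let f : EuclideanSpace ℝ (Fin n) → EuclideanSpace ℝ (Fin D) :=
    fun y => φ (EuclideanGeometry.orthogonalProjection S y)
  have hf (y z) : ‖f y - f z‖ ≤ dist y z := by
    rw [← dist_eq_norm]
    exact (φ.dist_map _ _).trans_le (dist_orthogonalProjection_le S y z)
  -- Recentring at `f 0` puts the net in the unit ball, since `M₀` lies in the unit ball about `0`.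
  have hcover : ∀ t ∈ projectedSet S φ M₀, ∃ v ∈ F.image (fun y => f y - f 0),
      ‖t - f 0 - v‖ ≤ σ / D := by
    rintro _ ⟨y, hy, rfl⟩
    obtain ⟨z, hz, hyz⟩ := hFnet y hy
    refine ⟨_, Finset.mem_image_of_mem _ hz, ?_⟩
    rw [sub_sub_sub_cancel_right]
    refine (hf y z).trans (hyz.trans_eq ?_)
    field_simp
  have hball : ∀ v ∈ F.image (fun y => f y - f 0), ‖v‖ ≤ 1 := by
    intro v hv
    obtain ⟨y, hy, rfl⟩ := Finset.mem_image.1 hv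
    exact (hf y 0).trans (hM (hFM y hy))
  obtain ⟨h1, h2, h3⟩ := integral_iSup_inner_le_of_net (hasLaw_smul_stdGaussian hσ hZ)
    (T := projectedSet S φ M₀) (hne.image _) (ε := σ / D) (L := Real.log A) (r := σ⁻¹)
    (by linarith) (by positivity) (by positivity) hcover hball
    (by
      rw [Real.exp_log hApos]
      exact le_trans (by exact_mod_cast Finset.card_image_le) hFA) x
  refine ⟨h1, h2, h3.trans ?_⟩
  rw [finrank_euclideanSpace_fin]
  have hs : 0 ≤ √(Real.log A) := Real.sqrt_nonneg _
  -- The `log (2D/σ)` term of `boundJ` is slack: only its sign matters.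
  have hl : 0 ≤ Real.log (2 * (D : ℝ) / σ) :=
    Real.log_nonneg (by rw [le_div_iff₀ hσ]; linarith)
  have h4 : σ⁻¹ * (2 * √(Real.log A) + σ / D * √(D : ℝ)) =
      σ⁻¹ * (2 * √(Real.log A)) + 1 / √(D : ℝ) := by
    rw [mul_add]
    congr 1
    rw [one_div, ← Real.sqrt_div_self]
    field_simp
  rw [h4]
  have h5 : 0 ≤ 1 / √(D : ℝ) := by positivity
  have h6 : 0 ≤ σ⁻¹ * √(Real.log A) := by positivity
  have h7 : 0 ≤ √(Real.log A) * (4 * σ⁻¹ * Real.log (2 * (D : ℝ) / σ)) := by positivity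
  linarith
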